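/- Let $n\ge 1$ be an integer and let $\delta,\epsilon>0$. Let $\mathcal D$ be the set of dyadic intervals $[j2^k,(j+1)2^k)$, $j,k\in\mathbb Z$, and let a dyadic rectangle be a product $R=R_1\times\cdots\times R_n\subset\mathbb R^n$ with all $R_j\in\mathcal D$. For a collection $\mathcal U$ of dyadic rectangles write $\mathrm{sh}(\mathcal U)=\bigcup_{R\in\mathcal U}R$ for its shadow, write $|\cdot|$ for Lebesgue measure, and for $\mu\ge 1$ let $\mu R$ be the rectangle with the same center as $R$ and all of its sides dilated by the factor $\mu$. There is a finite constant $K$, depending only on $n$, $\delta$ and $\epsilon$, such that the following holds. For every collection $\mathcal U$ of dyadic rectangles with $|\mathrm{sh}(\mathcal U)|<\infty$ there are a measurable set $V\supset\mathrm{sh}(\mathcal U)$, a function $\mathrm{emb}:\mathcal U\to[1,\infty)$ and a function $\imath:\mathcal U\to\{1,\dots,n\}$ such that $$|V|\le(1+\delta)\,|\mathrm{sh}(\mathcal U)|,$$ $$\mathrm{emb}(R)\,R\subset V\qquad\text{for all }R\in\mathcal U,$$ and, for every subcollection $\mathcal U'\subset\mathcal U$, $$\sum_{k=0}^\infty\sum_{m=1}^n\sum_{I\in\mathcal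 D}2^{-(n+\epsilon)k}\,|F(I,k,m,\mathcal U')|\le K\,|\mathrm{sh}(\mathcal U')|,$$ where $$F(I,k,m,\mathcal U')=\bigcup\{R\in\mathcal U' : 2^k\le\mathrm{emb}(R)<2^{k+1},\ \imath(R)=m,\ R_m=I\}.$$ -/

import Mathlib

open MeasureTheory
open scoped ENNReal NNReal

namespace Journe

/-- A dyadic interval of the real line, recorded by its scale `k` and position `j`: it stands for
`[j * 2 ^ k, (j + 1) * 2 ^ k)`. Distinct pairs give distinct intervals. -/
@[ext]
structure DyadicInterval where
  scale : ℤ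
  pos : ℤ

namespace DyadicInterval

/-- The length `2 ^ k` of a dyadic interval. -/
noncomputable def length (I : DyadicInterval) : ℝ := (2 : ℝ) ^ I.scale

/-- The center of a dyadic interval. -/
noncomputable def center (I : DyadicInterval) : ℝ := ((I.pos : ℝ) + 1 / 2) * I.length

/-- The dyadic interval as a set of reals. -/
def toSet (I : DyadicInterval) : Set ℝ :=
  Set.Ico ((I.pos : ℝ) * I.length) (((I.pos : ℝ) + 1) * I.length)

/-- The interval with the same center as `I` and `μ` times its length. -/
def dilate (μ : ℝ) (I : DyadicInterval) : Set ℝ :=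
  Set.Ico (I.center - μ * I.length / 2) (I.center + μ * I.length / 2)

end DyadicInterval

/-- A dyadic rectangle `R = R 0 × ⋯ × R (n - 1)` of `ℝ ^ n`, given by its sides. -/
abbrev DyadicRectangle (n : ℕ) : Type := Fin n → DyadicInterval

namespace DyadicRectangle

variable {n : ℕ}

/-- The dyadic rectangle as a subset of `ℝ ^ n`. -/
def toSet (R : DyadicRectangle n) : Set (Fin n → ℝ) :=
  {x | ∀ i, x i ∈ (R i).toSet}

/-- The dilate `μ R`: same center as `R`, every side dilated by the same factor `μ`. -/
def dilate (μ : ℝ) (R : DyadicRectangle n) : Set (Fin n → ℝ) :=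
  {x | ∀ i, x i ∈ (R i).dilate μ}

end DyadicRectangle

/-- The shadow of a collection of dyadic rectangles: the union of its members. -/
def shadow {n : ℕ} (U : Set (DyadicRectangle n)) : Set (Fin n → ℝ) :=
  ⋃ R ∈ U, R.toSet

/-- The union `F(I, k, m, U')` of the rectangles `R` in `U'` with `2 ^ k ≤ emb R < 2 ^ (k + 1)`, with
chosen coordinate `m`, and with `m`-th side `I`. -/
def levelUnion {n : ℕ} (emb : DyadicRectangle n → ℝ) (coord : DyadicRectangle n → Fin n)
    (I : DyadicInterval) (k : ℕ) (m : Fin n) (U' : Set (DyadicRectangle n)) :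
    Set (Fin n → ℝ) :=
  ⋃ R ∈ {R ∈ U' | (2 : ℝ) ^ k ≤ emb R ∧ emb R < (2 : ℝ) ^ (k + 1) ∧ coord R = m ∧ R m = I},
    R.toSet

end Journe

/-! Let W_0 be the shadow and let W_(m+1) enlarge W_m by one-dimensional maximal functions in all n
directions, with thresholds so strict that V = W_n costs only a factor 1 + δ. A box missing W_m in a
proportion less than η^n lies in W_(m+1) (`subset_expandList_finRange`). Take for `emb R` the last
power 2^k with 2^k R ⊆ V, and put l = 2^(k+1). Dilate the sides of R by l one at a time: the
undilated R lies in W_0 and the full dilate is not in W_n, so for some m the passage from W_m to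
W_(m+1) fails. This m is the chosen coordinate.

Fix k and m, and let D_R be R with its sides of index below m dilated by l. Let J be an ancestor of
R_m, at least l 2^c times longer. Suppose the D_R' with R'_m ⊇ J almost filled D_R. They are
constant along J in direction m, so they would almost fill the box obtained from D_R by replacing
R_m with J. They lie in W_m, so a slightly wider box, containing the next partial dilate of R, would
lie in W_(m+1): a contradiction. Hence D_R keeps a fixed proportion outside them
(`volume_partialDilate_le`).

These remainders control the full unions (`volume_sideUnion_le`) and overlap boundedly, since at any
point only A consecutive scales of R_m occur (`tsum_volume_sideUnion_diff_le`). The union of the D_R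
costs at most a factor of order l^n over the shadow (`volume_iUnion_partialDilate_le`). Level k
therefore costs O(k 2^(nk)), which is summable against 2^(-(n+ε)k). -/

namespace Journe

open Function

/-! ### One-dimensional covering and enlargement. -/

/-- A finite family of half-open intervals has a subfamily with the same union that covers no point
more than twice. -/
lemma exists_subset_biUnion_Ico_eq {ι : Type*} [DecidableEq ι] (s : Finset ι) (a b : ι → ℝ) :
    ∃ t ⊆ s, (⋃ i ∈ t, Set.Ico (a i) (b i)) = (⋃ i ∈ s, Set.Ico (a i) (b i)) ∧
      ∀ x, (t.filter fun i => x ∈ Set.Ico (a i) (b i)).card ≤ 2 := by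
  induction s using Finset.strongInduction with
  | H s ih =>
    by_cases h : ∀ x, (s.filter fun i => x ∈ Set.Ico (a i) (b i)).card ≤ 2
    · exact ⟨s, subset_rfl, rfl, h⟩
    push Not at h
    obtain ⟨x, hx⟩ := h
    set f := s.filter fun i => x ∈ Set.Ico (a i) (b i) with hf
    have hne : f.Nonempty := Finset.card_pos.1 (by omega)
    obtain ⟨i, hi, hia⟩ := f.exists_min_image a hne
    obtain ⟨j, hj, hjb⟩ := f.exists_max_image b hne
    -- Of the intervals through `x`, `i` reaches furthest left and `j` furthest right, so any third
    -- one is redundant.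
    obtain ⟨l, hl, hlij⟩ : ∃ l ∈ f, l ∉ ({i, j} : Finset ι) :=
      Finset.exists_mem_notMem_of_card_lt_card (Finset.card_le_two.trans_lt hx)
    simp only [Finset.mem_insert, Finset.mem_singleton, not_or] at hlij
    have hia' := hia l hl
    have hjb' := hjb l hl
    simp only [hf, Finset.mem_filter, Set.mem_Ico] at hi hj hl
    obtain ⟨t, hts, htu, htc⟩ := ih (s.erase l) (Finset.erase_ssubset hl.1)
    refine ⟨t, hts.trans (Finset.erase_subset _ _), htu.trans ?_, htc⟩
    refine subset_antisymm (Set.biUnion_subset_biUnion_left fun k hk => Finset.mem_of_mem_erase hk) ?_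
    intro y hy
    simp only [Set.mem_iUnion, Set.mem_Ico, Finset.mem_erase, exists_prop] at hy ⊢
    obtain ⟨k, hk, hy⟩ := hy
    by_cases hkl : k = l
    · subst hkl
      rcases lt_or_ge y x with hyx | hyx
      · exact ⟨i, ⟨Ne.symm hlij.1, hi.1⟩, by linarith, by linarith⟩
      · exact ⟨j, ⟨Ne.symm hlij.2, hj.1⟩, by linarith, by linarith⟩
    · exact ⟨k, ⟨hkl, hk⟩, hy⟩

/-- Sets inside `Y` that cover no point more than `N` times have total measure at most `N` times
the measure of `Y`. -/
lemma sum_measure_le_of_card_le {α ι : Type*} [MeasurableSpace α] (μ : Measure α) (s : Finset ι)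
    (A : ι → Set α) (hA : ∀ i ∈ s, MeasurableSet (A i)) (Y : Set α)
    (hAY : ∀ i ∈ s, A i ⊆ Y) (N : ℕ)
    (hN : ∀ x, ∀ t ⊆ s, (∀ i ∈ t, x ∈ A i) → t.card ≤ N) :
    ∑ i ∈ s, μ (A i) ≤ N * μ Y := by
  classical
  calc ∑ i ∈ s, μ (A i) = ∑ i ∈ s, ∫⁻ x, (A i).indicator 1 x ∂μ :=
        Finset.sum_congr rfl fun i hi => (lintegral_indicator_one (hA i hi)).symm
    _ = ∫⁻ x, ∑ i ∈ s, (A i).indicator 1 x ∂μ :=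
        (lintegral_finsetSum' _ fun i hi => (measurable_one.indicator (hA i hi)).aemeasurable).symm
    _ ≤ ∫⁻ x, Y.indicator (fun _ => (N : ℝ≥0∞)) x ∂μ := by
        refine lintegral_mono fun x => ?_
        by_cases hx : x ∈ Y
        · rw [Set.indicator_of_mem hx]
          have := hN x (s.filter fun i => x ∈ A i) (Finset.filter_subset _ _)
            (fun i hi => (Finset.mem_filter.1 hi).2)
          calc ∑ i ∈ s, (A i).indicator (1 : α → ℝ≥0∞) x
              = ∑ i ∈ s, if x ∈ A i then 1 else 0 := rfl
            _ = ((s.filter fun i => x ∈ A i).card : ℝ≥0∞) := by simp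
            _ ≤ N := by exact_mod_cast this
        · rw [Set.indicator_of_notMem hx]
          exact (Finset.sum_eq_zero fun i hi =>
            Set.indicator_of_notMem (fun h => hx (hAY i hi h)) _).le
    _ ≤ N * μ Y := lintegral_indicator_const_le _ _

/-- If the intervals `[a i, b i)` lie in `E` up to a proportion `η`, then adding them to `E`
enlarges the measure at most by the factor `1 + C`. -/
lemma volume_union_iUnion_Ico_le {ι : Type*} [Countable ι] (a b : ι → ℝ) (E : Set ℝ)
    (hE : MeasurableSet E) (η C : ℝ≥0) (hC : (C + 2) * η ≤ C)
    (h : ∀ i, volume (Set.Ico (a i) (b i) \ E) ≤ η * volume (Set.Ico (a i) (b i))) :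
    volume (E ∪ ⋃ i, Set.Ico (a i) (b i)) ≤ (1 + C) * volume E := by
  classical
  -- Split |I| into its parts inside and outside `E` and cancel C |I \ E|. The remaining factor 2
  -- pays for the double overlap of the covering.
  have key : ∀ i, 2 * volume (Set.Ico (a i) (b i) \ E) ≤ C * volume (Set.Ico (a i) (b i) ∩ E) := by
    intro i
    set I := Set.Ico (a i) (b i)
    have hIfin : volume I ≠ ∞ := by simp [I]
    have hd : volume (I \ E) ≠ ∞ := measure_ne_top_of_subset Set.sdiff_subset hIfin
    have h1 : (C + 2 : ℝ≥0∞) * volume (I \ E) ≤ C * volume I :=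
      calc (C + 2 : ℝ≥0∞) * volume (I \ E) ≤ (C + 2) * (η * volume I) := by gcongr; exact h i
        _ = ((C + 2) * η : ℝ≥0) * volume I := by push_cast; ring
        _ ≤ C * volume I := by gcongr
    rw [← measure_inter_add_sdiff I hE, mul_add, add_mul, add_comm] at h1
    exact (ENNReal.add_le_add_iff_right (ENNReal.mul_ne_top ENNReal.coe_ne_top hd)).1 h1
  have hfin : ∀ s : Finset ι, volume ((⋃ i ∈ s, Set.Ico (a i) (b i)) \ E) ≤ C * volume E := by
    intro s
    obtain ⟨t, -, htu, htc⟩ := exists_subset_biUnion_Ico_eq s a b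
    rw [← htu]
    simp only [Set.iUnion_sdiff]
    have h1 : ∑ i ∈ t, volume (Set.Ico (a i) (b i) ∩ E) ≤ (2 : ℕ) * volume E := by
      refine sum_measure_le_of_card_le _ _ _ (fun i _ => measurableSet_Ico.inter hE) _
        (fun i _ => Set.inter_subset_right) _ fun x u hu hxu => ?_
      exact (Finset.card_le_card fun i hi =>
        Finset.mem_filter.2 ⟨hu hi, (hxu i hi).1⟩).trans (htc x)
    have h2 : 2 * volume (⋃ i ∈ t, Set.Ico (a i) (b i) \ E) ≤ 2 * (C * volume E) :=
      calc 2 * volume (⋃ i ∈ t, Set.Ico (a i) (b i) \ E)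
          ≤ 2 * ∑ i ∈ t, volume (Set.Ico (a i) (b i) \ E) := by
            gcongr; exact measure_biUnion_finset_le _ _
        _ ≤ ∑ i ∈ t, C * volume (Set.Ico (a i) (b i) ∩ E) := by
            rw [Finset.mul_sum]; exact Finset.sum_le_sum fun i _ => key i
        _ ≤ C * ((2 : ℕ) * volume E) := by rw [← Finset.mul_sum]; gcongr
        _ = 2 * (C * volume E) := by push_cast; ring
    exact (ENNReal.mul_le_mul_iff_right (by simp) (by simp)).1 h2
  have hall : volume ((⋃ i, Set.Ico (a i) (b i)) \ E) ≤ C * volume E := by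
    have hmono : Monotone fun s : Finset ι => (⋃ i ∈ s, Set.Ico (a i) (b i)) \ E :=
      fun s t hst => Set.sdiff_subset_sdiff_left (Set.biUnion_subset_biUnion_left hst)
    rw [Set.iUnion_eq_iUnion_finset, Set.iUnion_sdiff, hmono.measure_iUnion]
    exact iSup_le hfin
  calc volume (E ∪ ⋃ i, Set.Ico (a i) (b i))
      = volume (E ∪ ((⋃ i, Set.Ico (a i) (b i)) \ E)) := by rw [Set.union_sdiff_self]
    _ ≤ volume E + C * volume E := (measure_union_le _ _).trans (by gcongr)
    _ = (1 + C) * volume E := by ring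

/-! ### Enlargement in one coordinate direction. -/

variable {n : ℕ}

lemma measurableSet_update_mem (j : Fin n) {A : Set (Fin n → ℝ)} (hA : MeasurableSet A)
    (x : Fin n → ℝ) : MeasurableSet {t | update x j t ∈ A} :=
  measurable_update x hA

/-- Comparison of measures through the sections in one coordinate direction. -/
lemma volume_le_of_forall_update (j : Fin n) {A B : Set (Fin n → ℝ)} (hA : MeasurableSet A)
    (hB : MeasurableSet B) (c : ℝ≥0∞)
    (h : ∀ x, volume {t | update x j t ∈ A} ≤ c * volume {t | update x j t ∈ B}) :
    volume A ≤ c * volume B := by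
  rw [← lintegral_indicator_one hA, ← lintegral_indicator_one hB,
    ← lintegral_const_mul _ (measurable_one.indicator hB)]
  refine lintegral_le_of_lmarginal_le (μ := fun _ => volume) {j} (measurable_one.indicator hA)
    ((measurable_one.indicator hB).const_mul c) ?_
  rw [lmarginal_singleton, lmarginal_singleton]
  intro x
  have hs : ∀ {S : Set (Fin n → ℝ)}, MeasurableSet S →
      ∫⁻ t, S.indicator 1 (update x j t) = volume {t | update x j t ∈ S} := fun hS =>
    lintegral_indicator_one (measurableSet_update_mem j hS x)
  calc ∫⁻ t, A.indicator 1 (update x j t) = volume {t | update x j t ∈ A} := hs hA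
    _ ≤ c * ∫⁻ t, B.indicator 1 (update x j t) := by rw [hs hB]; exact h x
    _ = ∫⁻ t, c * B.indicator 1 (update x j t) := (lintegral_const_mul _
        ((measurable_one.indicator hB).comp (measurable_update x))).symm

instance : Countable DyadicInterval :=
  Function.Injective.countable (f := fun I : DyadicInterval => (I.scale, I.pos))
    fun _ _ h => DyadicInterval.ext (congrArg Prod.fst h) (congrArg Prod.snd h)

lemma DyadicInterval.measurableSet_dilate (I : DyadicInterval) (μ : ℝ) :
    MeasurableSet (I.dilate μ) := measurableSet_Ico

lemma measurable_update_pair (j : Fin n) :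
    Measurable fun p : (Fin n → ℝ) × ℝ => update p.1 j p.2 := measurable_update'

/-- The points `x` such that some rational dilate of a dyadic interval contains `x j` and meets the
complement of `W`, along the line through `x` in direction `j`, in a proportion less than `η`. -/
def denseAlong (j : Fin n) (η : ℝ≥0) (W : Set (Fin n → ℝ)) (p : DyadicInterval × ℚ) :
    Set (Fin n → ℝ) :=
  {x | x j ∈ p.1.dilate p.2 ∧
    volume (p.1.dilate p.2 \ {t | update x j t ∈ W}) < η * volume (p.1.dilate p.2)}

/-- Enlargement of `W` by a maximal function in direction `j`. -/
def expandAlong (j : Fin n) (η : ℝ≥0) (W : Set (Fin n → ℝ)) : Set (Fin n → ℝ) :=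
  W ∪ ⋃ p, denseAlong j η W p

lemma subset_expandAlong (j : Fin n) (η : ℝ≥0) (W : Set (Fin n → ℝ)) :
    W ⊆ expandAlong j η W := Set.subset_union_left

lemma mem_expandAlong {j : Fin n} {η : ℝ≥0} {W : Set (Fin n → ℝ)} {x : Fin n → ℝ}
    (I : DyadicInterval) (μ : ℚ) (hx : x j ∈ I.dilate μ)
    (h : volume (I.dilate μ \ {t | update x j t ∈ W}) < η * volume (I.dilate μ)) :
    x ∈ expandAlong j η W :=
  Or.inr (Set.mem_iUnion.2 ⟨(I, μ), hx, h⟩)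

/-- Rational dilation factors keep the union countable, and the measure of the missed part of a line
depends measurably on `x` by Fubini. -/
lemma measurableSet_expandAlong (j : Fin n) (η : ℝ≥0) {W : Set (Fin n → ℝ)}
    (hW : MeasurableSet W) : MeasurableSet (expandAlong j η W) := by
  refine hW.union (MeasurableSet.iUnion fun p => ?_)
  have hS : MeasurableSet {q : (Fin n → ℝ) × ℝ | q.2 ∈ p.1.dilate p.2 ∧ update q.1 j q.2 ∉ W} :=
    (measurable_snd (p.1.measurableSet_dilate _)).inter (measurable_update_pair j hW).compl
  have hv : Measurable fun x : Fin n → ℝ =>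
      volume (p.1.dilate p.2 \ {t | update x j t ∈ W}) := measurable_measure_prodMk_left hS
  exact (measurable_pi_apply j (p.1.measurableSet_dilate _)).inter
    (measurableSet_lt hv measurable_const)

/-- The density condition does not see the coordinate `j`, so on each line one fixed family of
intervals is added, and the one-dimensional bound integrates over the lines. -/
lemma volume_expandAlong_le (j : Fin n) (η C : ℝ≥0) (hC : (C + 2) * η ≤ C)
    {W : Set (Fin n → ℝ)} (hW : MeasurableSet W) :
    volume (expandAlong j η W) ≤ (1 + C) * volume W := by
  refine volume_le_of_forall_update j (measurableSet_expandAlong j η hW) hW _ fun x => ?_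
  set E := {t | update x j t ∈ W}
  let G := {p : DyadicInterval × ℚ //
    volume (p.1.dilate p.2 \ E) < η * volume (p.1.dilate p.2)}
  have hsub : {t | update x j t ∈ expandAlong j η W} ⊆ E ∪ ⋃ p : G, Set.Ico
      (p.1.1.center - p.1.2 * p.1.1.length / 2) (p.1.1.center + p.1.2 * p.1.1.length / 2) := by
    rintro t (ht | ht)
    · exact Or.inl ht
    · obtain ⟨p, hp, hp'⟩ := Set.mem_iUnion.1 ht
      simp only [update_idem] at hp'
      rw [update_self] at hp
      exact Or.inr (Set.mem_iUnion.2 ⟨⟨p, hp'⟩, hp⟩)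
  exact (measure_mono hsub).trans (volume_union_iUnion_Ico_le _ _ E
    (measurableSet_update_mem j hW x) η C hC fun p => p.2.le)

/-! ### Enlargement in several directions and boxes. -/

/-- Successive enlargement along the directions of a list. -/
def expandList (η : ℝ≥0) (W : Set (Fin n → ℝ)) : List (Fin n) → Set (Fin n → ℝ)
  | [] => W
  | j :: l => expandAlong j η (expandList η W l)

lemma subset_expandList (η : ℝ≥0) (W : Set (Fin n → ℝ)) (l : List (Fin n)) :
    W ⊆ expandList η W l := by
  induction l with
  | nil => exact subset_rfl
  | cons j l ih => exact ih.trans (subset_expandAlong _ _ _)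

lemma measurableSet_expandList (η : ℝ≥0) {W : Set (Fin n → ℝ)} (hW : MeasurableSet W)
    (l : List (Fin n)) : MeasurableSet (expandList η W l) := by
  induction l with
  | nil => exact hW
  | cons j l ih => exact measurableSet_expandAlong _ _ ih

lemma volume_expandList_le (η C : ℝ≥0) (hC : (C + 2) * η ≤ C) {W : Set (Fin n → ℝ)}
    (hW : MeasurableSet W) (l : List (Fin n)) :
    volume (expandList η W l) ≤ (1 + C) ^ l.length * volume W := by
  induction l with
  | nil => simp [expandList]
  | cons j l ih =>
    calc volume (expandAlong j η (expandList η W l))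
        ≤ (1 + C) * volume (expandList η W l) :=
          volume_expandAlong_le j η C hC (measurableSet_expandList η hW l)
      _ ≤ (1 + C) * ((1 + C) ^ l.length * volume W) := by gcongr
      _ = (1 + C) ^ (l.length + 1) * volume W := by ring

/-- The box with sides `(Q i).dilate (μ i)`. -/
def box (Q : DyadicRectangle n) (μ : Fin n → ℚ) : Set (Fin n → ℝ) :=
  {x | ∀ i, x i ∈ (Q i).dilate (μ i)}

lemma box_eq_pi (Q : DyadicRectangle n) (μ : Fin n → ℚ) :
    box Q μ = Set.pi Set.univ fun i => (Q i).dilate (μ i) := by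
  ext x; simp [box]

lemma measurableSet_box (Q : DyadicRectangle n) (μ : Fin n → ℚ) : MeasurableSet (box Q μ) := by
  rw [box_eq_pi]
  exact MeasurableSet.univ_pi fun i => (Q i).measurableSet_dilate _

lemma volume_box (Q : DyadicRectangle n) (μ : Fin n → ℚ) :
    volume (box Q μ) = ∏ i, volume ((Q i).dilate (μ i)) := by
  rw [box_eq_pi, volume_pi_pi]

lemma volume_box_ne_top (Q : DyadicRectangle n) (μ : Fin n → ℚ) : volume (box Q μ) ≠ ∞ := by
  rw [volume_box]
  exact ENNReal.prod_ne_top fun i _ => by simp [DyadicInterval.dilate]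

lemma update_mem_box {Q : DyadicRectangle n} {μ : Fin n → ℚ} {x : Fin n → ℝ} (hx : x ∈ box Q μ)
    {j : Fin n} {t : ℝ} (ht : t ∈ (Q j).dilate (μ j)) : update x j t ∈ box Q μ := by
  intro i
  rcases eq_or_ne i j with rfl | hij
  · simpa using ht
  · simpa [hij] using hx i

/-- The part of a box missed by the enlargement along the directions of `l` lies in a set which is
invariant in these directions and at most `η⁻¹ ^ l.length` times larger than the part missed by
the original set. -/
lemma exists_invariant_superset (η : ℝ≥0) {W : Set (Fin n → ℝ)} (hW : MeasurableSet W)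
    (Q : DyadicRectangle n) (μ : Fin n → ℚ) (l : List (Fin n)) :
    ∃ Z ⊆ box Q μ, MeasurableSet Z ∧ box Q μ \ expandList η W l ⊆ Z ∧
      (∀ x ∈ Z, ∀ j ∈ l, ∀ t ∈ (Q j).dilate (μ j), update x j t ∈ Z) ∧
      η ^ l.length * volume Z ≤ volume (box Q μ \ W) := by
  induction l with
  | nil =>
    exact ⟨box Q μ \ W, Set.sdiff_subset, (measurableSet_box Q μ).diff hW, subset_rfl, by simp,
      by simp⟩
  | cons j l ih =>
    obtain ⟨Z, hZB, hZm, hZ, hinv, hvol⟩ := ih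
    set I := (Q j).dilate (μ j) with hI
    have hIm : MeasurableSet I := (Q j).measurableSet_dilate _
    have hsec : Measurable fun x : Fin n → ℝ => volume {t ∈ I | update x j t ∈ Z} :=
      measurable_measure_prodMk_left
        ((measurable_snd hIm).inter (measurable_update_pair j hZm))
    -- The new set consists of the points of the box whose line in direction `j` meets the old `Z`
    -- in at least a proportion η of the side.
    refine ⟨{x ∈ box Q μ | η * volume I ≤ volume {t ∈ I | update x j t ∈ Z}}, fun x hx => hx.1,
      (measurableSet_box Q μ).inter (measurableSet_le measurable_const hsec), ?_, ?_, ?_⟩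
    · rintro x ⟨hx, hxe⟩
      refine ⟨hx, ?_⟩
      by_contra hlt
      refine hxe (mem_expandAlong (Q j) (μ j) (hx j) (lt_of_le_of_lt (measure_mono ?_)
        (not_le.1 hlt)))
      exact fun t ht => ⟨ht.1, hZ ⟨update_mem_box hx ht.1, ht.2⟩⟩
    · rintro x ⟨hx, hxv⟩ i hi t ht
      refine ⟨update_mem_box hx ht, hxv.trans (measure_mono ?_)⟩
      rintro s ⟨hs, hsZ⟩
      refine ⟨hs, ?_⟩
      rcases eq_or_ne i j with rfl | hij
      · simpa using hsZ
      · rw [update_comm hij]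
        exact hinv _ hsZ i ((List.mem_cons.1 hi).resolve_left hij) t ht
    · refine le_trans ?_ hvol
      rw [List.length_cons, pow_succ, mul_assoc]
      gcongr
      rcases eq_or_ne η 0 with rfl | hη
      · simp
      have hη0 : (η : ℝ≥0∞) ≠ 0 := by simpa using hη
      rw [ENNReal.mul_le_iff_le_inv hη0 ENNReal.coe_ne_top]
      refine volume_le_of_forall_update j
        ((measurableSet_box Q μ).inter (measurableSet_le measurable_const hsec)) hZm _ fun x => ?_
      rw [← ENNReal.mul_le_iff_le_inv hη0 ENNReal.coe_ne_top]
      -- Membership depends on coordinate `j` only through the box: one point in the section already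
      -- gives the lower bound for the whole line.
      rcases Set.eq_empty_or_nonempty {t | update x j t ∈
        {x ∈ box Q μ | η * volume I ≤ volume {t ∈ I | update x j t ∈ Z}}} with he | ⟨t, ht⟩
      · erw [he]; simp
      · have h2 := ht.2
        simp only [update_idem] at h2
        refine le_trans ?_ (h2.trans (measure_mono fun s hs => hs.2))
        gcongr
        intro s hs
        simpa using hs.1 j

/-- A missed point lies in a set `Z` invariant in every direction. Changing its coordinates one at a
time reaches the whole box, so `Z` is too large for the assumed density. -/
lemma subset_expandList_finRange {η : ℝ≥0} {W : Set (Fin n → ℝ)} (hW : MeasurableSet W)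
    (Q : DyadicRectangle n) (μ : Fin n → ℚ)
    (h : volume (box Q μ \ W) < η ^ n * volume (box Q μ)) :
    box Q μ ⊆ expandList η W (List.finRange n) := by
  obtain ⟨Z, hZB, hZm, hZ, hinv, hvol⟩ := exists_invariant_superset η hW Q μ (List.finRange n)
  rw [List.length_finRange] at hvol
  intro y hy
  by_contra hye
  have hyZ : y ∈ Z := hZ ⟨hy, hye⟩
  have hBZ : box Q μ ⊆ Z := by
    intro x hx
    have : ∀ s : Finset (Fin n), s.piecewise x y ∈ Z := by
      intro s
      induction s using Finset.induction_on with
      | empty => simpa using hyZ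
      | insert i s _ ih =>
        rw [Finset.piecewise_insert]
        exact hinv _ ih i (List.mem_finRange i) _ (hx i)
    simpa using this Finset.univ
  exact absurd h (not_lt.2 (le_trans (by gcongr) hvol))

/-! ### Geometry of dyadic intervals. -/

namespace DyadicInterval

lemma length_pos (I : DyadicInterval) : 0 < I.length := zpow_pos (by norm_num) _

lemma dilate_one (I : DyadicInterval) : I.dilate 1 = I.toSet := by
  unfold dilate toSet center
  congr 1 <;> ring

lemma volume_dilate (I : DyadicInterval) (μ : ℝ) :
    volume (I.dilate μ) = ENNReal.ofReal (μ * I.length) := by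
  rw [dilate, Real.volume_Ico]
  congr 1
  ring

/-- The dyadic interval `A` generations above `I`. -/
def ancestor (A : ℕ) (I : DyadicInterval) : DyadicInterval := ⟨I.scale + A, I.pos / 2 ^ A⟩

lemma length_ancestor (A : ℕ) (I : DyadicInterval) :
    (I.ancestor A).length = 2 ^ A * I.length := by
  simp only [length, ancestor]
  rw [zpow_add₀ (by norm_num), zpow_natCast, mul_comm]

lemma toSet_subset_ancestor (A : ℕ) (I : DyadicInterval) : I.toSet ⊆ (I.ancestor A).toSet := by
  have hpos : (0 : ℤ) < 2 ^ A := by positivity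
  have h1 : I.pos / 2 ^ A * 2 ^ A ≤ I.pos := Int.ediv_mul_le _ hpos.ne'
  have h2 : I.pos + 1 ≤ (I.pos / 2 ^ A + 1) * 2 ^ A := Int.lt_ediv_add_one_mul_self _ hpos
  have h1' : ((I.pos / 2 ^ A : ℤ) : ℝ) * 2 ^ A ≤ I.pos := by exact_mod_cast h1
  have h2' : (I.pos : ℝ) + 1 ≤ (((I.pos / 2 ^ A : ℤ) : ℝ) + 1) * 2 ^ A := by exact_mod_cast h2
  unfold toSet
  rw [length_ancestor]
  refine Set.Ico_subset_Ico ?_ ?_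
  · rw [← mul_assoc]
    exact mul_le_mul_of_nonneg_right h1' I.length_pos.le
  · rw [← mul_assoc]
    exact mul_le_mul_of_nonneg_right h2' I.length_pos.le

/-- Of two intersecting dyadic intervals, one contains the other. -/
lemma toSet_subset_of_mem {I J : DyadicInterval} {x : ℝ} (hI : x ∈ I.toSet) (hJ : x ∈ J.toSet)
    (h : I.scale ≤ J.scale) : I.toSet ⊆ J.toSet := by
  obtain ⟨d, hd⟩ := Int.le.dest h
  have hl : J.length = 2 ^ d * I.length := by
    rw [length, ← hd, zpow_add₀ (by norm_num), zpow_natCast, mul_comm, length]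
  simp only [toSet, Set.mem_Ico] at hI hJ
  rw [hl, ← mul_assoc, ← mul_assoc] at hJ
  have h1 : (I.pos : ℝ) < ((J.pos : ℝ) + 1) * 2 ^ d :=
    lt_of_mul_lt_mul_right (hI.1.trans_lt hJ.2) I.length_pos.le
  have h2 : (J.pos : ℝ) * 2 ^ d < I.pos + 1 :=
    lt_of_mul_lt_mul_right (hJ.1.trans_lt hI.2) I.length_pos.le
  have h1' : I.pos < (J.pos + 1) * 2 ^ d := by exact_mod_cast h1
  have h2' : J.pos * 2 ^ d < I.pos + 1 := by exact_mod_cast h2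
  have h1'' : (I.pos : ℝ) + 1 ≤ ((J.pos : ℝ) + 1) * 2 ^ d := by
    exact_mod_cast Int.add_one_le_iff.2 h1'
  have h2'' : (J.pos : ℝ) * 2 ^ d ≤ I.pos := by exact_mod_cast Int.lt_add_one_iff.1 h2'
  unfold toSet
  rw [hl, ← mul_assoc, ← mul_assoc]
  exact Set.Ico_subset_Ico (mul_le_mul_of_nonneg_right h2'' I.length_pos.le)
    (mul_le_mul_of_nonneg_right h1'' I.length_pos.le)

lemma eq_of_mem_of_scale_eq {I J : DyadicInterval} {x : ℝ} (hI : x ∈ I.toSet) (hJ : x ∈ J.toSet)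
    (h : I.scale = J.scale) : I = J := by
  have hl : J.length = I.length := by rw [length, length, h]
  simp only [toSet, Set.mem_Ico, hl] at hI hJ
  have h1 : (I.pos : ℝ) < J.pos + 1 := lt_of_mul_lt_mul_right (hI.1.trans_lt hJ.2) I.length_pos.le
  have h2 : (J.pos : ℝ) < I.pos + 1 := lt_of_mul_lt_mul_right (hJ.1.trans_lt hI.2) I.length_pos.le
  have h1' : I.pos < J.pos + 1 := by exact_mod_cast h1
  have h2' : J.pos < I.pos + 1 := by exact_mod_cast h2
  exact DyadicInterval.ext h (by omega)

/-- The dilate of `I` overshoots `I` by (μ - 1)|I|/2 on each side, which is at most the margin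
θ|J|/2. -/
lemma dilate_subset_dilate {I J : DyadicInterval} {μ θ : ℝ} (h : I.toSet ⊆ J.toSet)
    (hμ : μ * I.length ≤ θ * J.length) : I.dilate μ ⊆ J.dilate (1 + θ) := by
  have hI := I.length_pos
  unfold toSet at h
  rw [Set.Ico_subset_Ico_iff (by nlinarith)] at h
  unfold dilate center
  refine Set.Ico_subset_Ico ?_ ?_ <;> nlinarith [h.1, h.2]

end DyadicInterval

/-! ### Partial dilates and the Carleson estimate at one level. -/

/-- Dilation factors of the rectangle whose first `m` sides are dilated by `l`. -/
def partialFactor (m : ℕ) (l : ℚ) (i : Fin n) : ℚ := if (i : ℕ) < m then l else 1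

/-- The rectangle `R` with its first `m` sides dilated by `l`. -/
def partialDilate (m : ℕ) (l : ℚ) (R : DyadicRectangle n) : Set (Fin n → ℝ) :=
  box R (partialFactor m l)

lemma partialDilate_zero (l : ℚ) (R : DyadicRectangle n) : partialDilate 0 l R = R.toSet := by
  ext x
  simp [partialDilate, box, partialFactor, DyadicRectangle.toSet, DyadicInterval.dilate_one]

lemma partialDilate_self (l : ℚ) (R : DyadicRectangle n) : partialDilate n l R = R.dilate l := by
  ext x
  simp [partialDilate, box, partialFactor, DyadicRectangle.dilate]

lemma DyadicInterval.toSet_subset_dilate {l : ℝ} (hl : 1 ≤ l) (I : DyadicInterval) :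
    I.toSet ⊆ I.dilate l := by
  rw [← I.dilate_one]
  have hI := I.length_pos
  unfold DyadicInterval.dilate
  refine Set.Ico_subset_Ico ?_ ?_ <;> nlinarith

lemma toSet_subset_partialDilate (m : ℕ) {l : ℚ} (hl : 1 ≤ l) (R : DyadicRectangle n) :
    R.toSet ⊆ partialDilate m l R := by
  intro x hx i
  unfold partialFactor
  split_ifs
  · exact (R i).toSet_subset_dilate (by exact_mod_cast hl) (hx i)
  · rw [Rat.cast_one, DyadicInterval.dilate_one]
    exact hx i

lemma measurableSet_partialDilate (m : ℕ) (l : ℚ) (R : DyadicRectangle n) :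
    MeasurableSet (partialDilate m l R) := measurableSet_box _ _

lemma partialFactor_self (m : Fin n) (l : ℚ) : partialFactor m l m = 1 := by
  simp [partialFactor]

lemma mem_toSet_of_mem_partialDilate {m : Fin n} {l : ℚ} {R : DyadicRectangle n} {x : Fin n → ℝ}
    (hx : x ∈ partialDilate m l R) : x m ∈ (R m).toSet := by
  have := hx m
  rwa [partialFactor_self, Rat.cast_one, DyadicInterval.dilate_one] at this

lemma update_mem_partialDilate {m : Fin n} {l : ℚ} {R : DyadicRectangle n} {x : Fin n → ℝ}
    (hx : x ∈ partialDilate m l R) {t : ℝ} (ht : t ∈ (R m).toSet) :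
    update x m t ∈ partialDilate m l R := by
  refine update_mem_box hx ?_
  rwa [partialFactor_self, Rat.cast_one, DyadicInterval.dilate_one]

lemma volume_box_update (R : DyadicRectangle n) (μ : Fin n → ℚ) (m : Fin n) (J : DyadicInterval)
    (a : ℚ) : volume (box (update R m J) (update μ m a)) =
      volume (J.dilate a) * ∏ i ∈ Finset.univ.erase m, volume ((R i).dilate (μ i)) := by
  rw [volume_box, ← Finset.mul_prod_erase _ _ (Finset.mem_univ m)]
  simp only [update_self]
  congr 1
  refine Finset.prod_congr rfl fun i hi => ?_
  rw [update_of_ne (Finset.ne_of_mem_erase hi), update_of_ne (Finset.ne_of_mem_erase hi)]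

/-- The union of the partially dilated members of `T` whose side `m` contains the `A`-th ancestor
of `I`. -/
def longUnion (T : Set (DyadicRectangle n)) (m : Fin n) (l : ℚ) (A : ℕ) (I : DyadicInterval) :
    Set (Fin n → ℝ) :=
  ⋃ R ∈ {R ∈ T | (I.ancestor A).toSet ⊆ (R m).toSet}, partialDilate m l R

lemma measurableSet_longUnion (T : Set (DyadicRectangle n)) (m : Fin n) (l : ℚ) (A : ℕ)
    (I : DyadicInterval) : MeasurableSet (longUnion T m l A I) :=
  MeasurableSet.biUnion (Set.to_countable _) fun R _ => measurableSet_partialDilate _ _ R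

lemma update_mem_longUnion {T : Set (DyadicRectangle n)} {m : Fin n} {l : ℚ} {A : ℕ}
    {I : DyadicInterval} {x : Fin n → ℝ} (hx : x ∈ longUnion T m l A I) {t : ℝ}
    (ht : t ∈ (I.ancestor A).toSet) : update x m t ∈ longUnion T m l A I := by
  simp only [longUnion, Set.mem_iUnion] at hx ⊢
  obtain ⟨R, hR, hx⟩ := hx
  exact ⟨R, hR, update_mem_partialDilate hx (hR.2 ht)⟩

/-- A rectangle which expands inside `W` in its first `m` directions but does not expand in the
direction `m` is not essentially covered by the rectangles with a much longer side `m`. -/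
lemma volume_partialDilate_le {η : ℝ≥0} {W : Set (Fin n → ℝ)} (hW : MeasurableSet W)
    {T : Set (DyadicRectangle n)} {m : Fin n} {l : ℚ} {A c : ℕ} (hA : l * 2 ^ c ≤ 2 ^ A)
    (hc : 2 ≤ η ^ n * 2 ^ c) (h1 : ∀ R ∈ T, partialDilate m l R ⊆ W)
    {R : DyadicRectangle n}
    (h2 : ¬ partialDilate (m + 1) l R ⊆ expandList η W (List.finRange n)) :
    volume (partialDilate m l R) ≤
      2 ^ c * volume (partialDilate m l R \ longUnion T m l A (R m)) := by
  set D := partialDilate m l R with hD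
  set S := longUnion T m l A (R m) with hS
  set J := (R m).ancestor A with hJ
  set f : Fin n → ℚ := partialFactor m l with hf
  -- The margin 2^(-c) is large enough for the l-dilate of `R m`, because l ≤ 2^(A-c), and small
  -- enough that `B \ B'` uses up at most half of the part of `B` outside `W`.
  set a : ℚ := 1 + (2 ^ c)⁻¹ with ha
  set B := box (update R m J) (update f m a) with hB
  set B' := box (update R m J) (update f m 1) with hB'
  set P := ∏ i ∈ Finset.univ.erase m, volume ((R i).dilate (f i)) with hP
  have hfm : update f m 1 = f := by
    rw [← partialFactor_self m l]; exact update_eq_self m f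
  have hDbox : D = box (update R m (R m)) (update f m 1) := by rw [hfm, update_eq_self]; rfl
  have hSm : MeasurableSet S := measurableSet_longUnion _ _ _ _ _
  have hDm : MeasurableSet D := measurableSet_partialDilate _ _ _
  have hSW : S ⊆ W := Set.iUnion₂_subset fun R' hR' => h1 R' hR'.1
  have hvB : volume B = volume (J.dilate a) * P := volume_box_update _ _ _ _ _
  have hvB' : volume B' = volume (J.dilate (1 : ℚ)) * P := volume_box_update _ _ _ _ _
  have hvD : volume D = volume ((R m).dilate (1 : ℚ)) * P := by
    rw [hDbox]; exact volume_box_update _ _ _ _ _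
  have hJR : volume (J.dilate (1 : ℚ)) = 2 ^ A * volume ((R m).dilate (1 : ℚ)) := by
    rw [DyadicInterval.volume_dilate, DyadicInterval.volume_dilate, hJ,
      DyadicInterval.length_ancestor, Rat.cast_one, one_mul, one_mul,
      ENNReal.ofReal_mul (by positivity), ENNReal.ofReal_pow (by norm_num)]
    simp
  have hJa : 2 ^ c * volume (J.dilate a) =
      2 ^ c * volume (J.dilate (1 : ℚ)) + volume (J.dilate (1 : ℚ)) := by
    have hp := J.length_pos
    have h2c : (2 : ℝ≥0∞) ^ c = ENNReal.ofReal (2 ^ c) := by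
      rw [ENNReal.ofReal_pow (by norm_num)]; simp
    rw [DyadicInterval.volume_dilate, DyadicInterval.volume_dilate, h2c,
      ← ENNReal.ofReal_mul (by positivity), ← ENNReal.ofReal_mul (by positivity),
      ← ENNReal.ofReal_add (by positivity) (by positivity)]
    congr 1
    rw [ha]; push_cast
    field_simp
  have hB'B : B' ⊆ B := by
    intro x hx i
    have := hx i
    rcases eq_or_ne i m with rfl | him
    · rw [update_self] at this ⊢
      rw [update_self] at this ⊢
      rw [Rat.cast_one, DyadicInterval.dilate_one] at this
      refine J.toSet_subset_dilate ?_ this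
      rw [ha]; push_cast
      have : (0 : ℝ) ≤ (2 ^ c)⁻¹ := by positivity
      linarith
    · rw [update_of_ne him, update_of_ne him] at this ⊢
      exact this
  have hBtop : ∀ a : ℚ, volume (box (update R m J) (update f m a)) ≠ ∞ :=
    fun _ => volume_box_ne_top _ _
  have hdiff : 2 ^ c * volume (B \ B') ≤ volume B' := by
    have e1 : volume B = volume B' + volume (B \ B') := by
      rw [← measure_inter_add_sdiff B (measurableSet_box _ _ : MeasurableSet B'),
        Set.inter_eq_self_of_subset_right hB'B]
    have e2 : 2 ^ c * volume B = 2 ^ c * volume B' + volume B' := by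
      rw [hvB, hvB', ← mul_assoc, hJa]; ring
    rw [e1, mul_add] at e2
    exact ((ENNReal.add_right_inj (ENNReal.mul_ne_top (by simp) (hBtop 1))).1 e2).le
  have hDB : partialDilate (m + 1) l R ⊆ B := by
    intro x hx i
    have := hx i
    rcases eq_or_ne i m with rfl | him
    · simp only [update_self]
      rw [partialFactor, if_pos (by omega)] at this
      rw [ha]; push_cast
      refine DyadicInterval.dilate_subset_dilate ((R i).toSet_subset_ancestor A) ?_ this
      rw [DyadicInterval.length_ancestor, ← mul_assoc]
      refine mul_le_mul_of_nonneg_right ?_ (R i).length_pos.le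
      have hA' : (l : ℝ) * 2 ^ c ≤ 2 ^ A := by exact_mod_cast hA
      rw [← div_eq_inv_mul, le_div_iff₀ (by positivity)]
      exact hA'
    · rw [update_of_ne him, update_of_ne him]
      have hne : (i : ℕ) ≠ m := fun h => him (Fin.ext h)
      have : (f i : ℚ) = partialFactor (m + 1) l i := by
        simp only [hf, partialFactor]
        congr 1
        exact propext ⟨fun h => by omega, fun h => by omega⟩
      rw [this]
      exact hx i
  -- Otherwise `B`, and with it the next partial dilate, would lie in the enlargement.
  have hBW : η ^ n * volume B ≤ volume (B \ W) := by
    by_contra hlt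
    exact h2 (hDB.trans (subset_expandList_finRange hW _ _ (not_le.1 hlt)))
  -- Both `B'` and `S` are constant along `J` in direction `m`, so passing from the side `R m` to
  -- `J` multiplies the uncovered part by at most |J|/|R m| = 2^A.
  have hsec : volume (B' \ S) ≤ 2 ^ A * volume (D \ S) := by
    refine volume_le_of_forall_update m ((measurableSet_box _ _).diff hSm) (hDm.diff hSm) _
      fun x => ?_
    rcases Set.eq_empty_or_nonempty {t | update x m t ∈ B' \ S} with he | ⟨t, ht⟩
    · rw [he]; simp
    have hB'J : ∀ s, update x m s ∈ B' → s ∈ J.toSet := by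
      intro s hs
      have := hs m
      simpa [DyadicInterval.dilate_one] using this
    calc volume {t | update x m t ∈ B' \ S} ≤ volume (J.dilate (1 : ℚ)) := by
          refine measure_mono fun s hs => ?_
          rw [Rat.cast_one, DyadicInterval.dilate_one]
          exact hB'J s hs.1
      _ = 2 ^ A * volume ((R m).dilate (1 : ℚ)) := hJR
      _ ≤ 2 ^ A * volume {t | update x m t ∈ D \ S} := by
          gcongr
          intro s hs
          rw [Rat.cast_one, DyadicInterval.dilate_one] at hs
          refine ⟨?_, fun hsS => ht.2 ?_⟩
          · intro i
            rcases eq_or_ne i m with rfl | him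
            · rw [update_self, partialFactor_self, Rat.cast_one, DyadicInterval.dilate_one]
              exact hs
            · have := ht.1 i
              rw [update_of_ne him, update_of_ne him, update_of_ne him] at this
              have e : update x m s i = x i := update_of_ne him s x
              rw [e]
              exact this
          · have := update_mem_longUnion hsS (hB'J t ht.1)
            rwa [update_idem] at this
  have hmain : volume B' + volume B' ≤ volume B' + 2 ^ A * (2 ^ c * volume (D \ S)) :=
    calc volume B' + volume B' = 2 * volume B' := by ring
      _ ≤ ((η ^ n * 2 ^ c : ℝ≥0) : ℝ≥0∞) * volume B := by
          gcongr; exact_mod_cast hc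
      _ = 2 ^ c * (η ^ n * volume B) := by push_cast; ring
      _ ≤ 2 ^ c * volume (B \ W) := by gcongr
      _ ≤ 2 ^ c * (volume (B \ B') + volume (B' \ S)) := by
          gcongr
          refine (measure_mono fun x hx => ?_).trans (measure_union_le _ _)
          by_cases hxB : x ∈ B'
          · exact Or.inr ⟨hxB, fun h => hx.2 (hSW h)⟩
          · exact Or.inl ⟨hx.1, hxB⟩
      _ ≤ volume B' + 2 ^ c * (2 ^ A * volume (D \ S)) := by
          rw [mul_add]; gcongr
      _ = volume B' + 2 ^ A * (2 ^ c * volume (D \ S)) := by ring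
  have hfinal := (ENNReal.add_le_add_iff_left (hBtop 1)).1 hmain
  have : volume B' = 2 ^ A * volume D := by rw [hvB', hvD, hJR, mul_assoc]
  rw [this] at hfinal
  exact (ENNReal.mul_le_mul_iff_right (by simp) (by simp)).1 hfinal

/-- The union of the partially dilated members of `T` with side `m` equal to `I`. -/
def sideUnion (T : Set (DyadicRectangle n)) (m : Fin n) (l : ℚ) (I : DyadicInterval) :
    Set (Fin n → ℝ) :=
  ⋃ R ∈ {R ∈ T | R m = I}, partialDilate m l R

lemma measurableSet_sideUnion (T : Set (DyadicRectangle n)) (m : Fin n) (l : ℚ)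
    (I : DyadicInterval) : MeasurableSet (sideUnion T m l I) :=
  MeasurableSet.biUnion (Set.to_countable _) fun R _ => measurableSet_partialDilate _ _ R

lemma volume_partialDilate_ne_zero (m : ℕ) {l : ℚ} (hl : 1 ≤ l) (R : DyadicRectangle n) :
    volume (partialDilate m l R) ≠ 0 := by
  rw [partialDilate, volume_box, Finset.prod_ne_zero_iff]
  intro i _
  rw [DyadicInterval.volume_dilate]
  refine (ENNReal.ofReal_pos.2 (mul_pos ?_ (R i).length_pos)).ne'
  rw [partialFactor]
  split_ifs
  · exact_mod_cast zero_lt_one.trans_le hl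
  · norm_num

/-- Each partial dilate meets the remainder in a proportion at least 2^(-c). As `hη` says 1 - 2^(-c)
< η^n, a loose enlargement of the remainder, with η near 1, recovers every one of them. -/
lemma volume_sideUnion_le {T : Set (DyadicRectangle n)} {m : Fin n} {l : ℚ} (hl : 1 ≤ l)
    {A c : ℕ} {η C : ℝ≥0} (hC : (C + 2) * η ≤ C) (hη : 2 ^ c < 2 ^ c * η ^ n + 1)
    (h : ∀ R ∈ T, volume (partialDilate m l R) ≤
      2 ^ c * volume (partialDilate m l R \ longUnion T m l A (R m))) (I : DyadicInterval) :
    volume (sideUnion T m l I) ≤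
      (1 + C) ^ n * volume (sideUnion T m l I \ longUnion T m l A I) := by
  have hSm := measurableSet_longUnion T m l A I
  have hm : MeasurableSet (sideUnion T m l I \ longUnion T m l A I) :=
    (measurableSet_sideUnion T m l I).diff hSm
  have hv := volume_expandList_le η C hC hm (List.finRange n)
  rw [List.length_finRange] at hv
  refine (measure_mono (Set.iUnion₂_subset ?_)).trans hv
  rintro R ⟨hR, rfl⟩
  refine subset_expandList_finRange hm R _ ?_
  change volume (partialDilate m l R \ _) < η ^ n * volume (partialDilate m l R)
  set D := partialDilate m l R with hD
  set S := longUnion T m l A (R m)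
  have hsub : D \ (sideUnion T m l (R m) \ S) ⊆ D ∩ S := by
    intro x hx
    refine ⟨hx.1, by_contra fun hxS => hx.2 ⟨Set.mem_biUnion ⟨hR, rfl⟩ hx.1, hxS⟩⟩
  refine (measure_mono hsub).trans_lt (not_le.1 fun hle => ?_)
  have h1 : ((2 ^ c * η ^ n + 1 : ℝ≥0) : ℝ≥0∞) * volume D ≤ ((2 ^ c : ℝ≥0) : ℝ≥0∞) * volume D :=
    calc ((2 ^ c * η ^ n + 1 : ℝ≥0) : ℝ≥0∞) * volume D
        = 2 ^ c * (η ^ n * volume D) + volume D := by push_cast; ring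
      _ ≤ 2 ^ c * volume (D ∩ S) + 2 ^ c * volume (D \ S) := by
          gcongr; exact h R hR
      _ = ((2 ^ c : ℝ≥0) : ℝ≥0∞) * volume D := by
          rw [← mul_add, measure_inter_add_sdiff D hSm]; push_cast; rfl
  have h2 := (ENNReal.mul_le_mul_iff_left (volume_partialDilate_ne_zero m hl R)
    (volume_box_ne_top _ _)).1 h1
  exact absurd hη (not_lt.2 (by exact_mod_cast h2))

/-- The intervals `I` contributing at `x` all contain `x m`, so they are nested with distinct
scales. If one were at least `A` generations above another, it would contain the ancestor, and `x`
would have been removed from the smaller one's remainder. -/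
lemma tsum_volume_sideUnion_diff_le (T : Set (DyadicRectangle n)) (m : Fin n) (l : ℚ) (A : ℕ) :
    ∑' I, volume (sideUnion T m l I \ longUnion T m l A I) ≤
      A * volume (⋃ R ∈ T, partialDilate m l R) := by
  rw [ENNReal.tsum_eq_iSup_sum]
  refine iSup_le fun s => sum_measure_le_of_card_le _ s _
    (fun I _ => (measurableSet_sideUnion T m l I).diff (measurableSet_longUnion T m l A I)) _
    (fun I _ x hx => ?_) A fun x t _ ht => ?_
  · obtain ⟨R, hR, hx⟩ := Set.mem_iUnion₂.1 hx.1
    exact Set.mem_biUnion hR.1 hx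
  · have hmem : ∀ I ∈ t, ∃ R ∈ T, R m = I ∧ x ∈ partialDilate m l R := by
      intro I hI
      obtain ⟨R, hR, hx⟩ := Set.mem_iUnion₂.1 (ht I hI).1
      exact ⟨R, hR.1, hR.2, hx⟩
    have hside : ∀ I ∈ t, x m ∈ I.toSet := by
      intro I hI
      obtain ⟨R, -, rfl, hx⟩ := hmem I hI
      exact mem_toSet_of_mem_partialDilate hx
    have hscale : ∀ I ∈ t, ∀ J ∈ t, J.scale < I.scale + A := by
      intro I hI J hJ
      by_contra! hlt
      obtain ⟨R, hR, rfl, hx⟩ := hmem J hJ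
      exact (ht I hI).2 (Set.mem_biUnion ⟨hR, DyadicInterval.toSet_subset_of_mem
        (I.toSet_subset_ancestor A (hside I hI)) (hside _ hJ) hlt⟩ hx)
    rcases t.eq_empty_or_nonempty with rfl | hne
    · simp
    obtain ⟨I, hI, hmin⟩ := t.exists_min_image DyadicInterval.scale hne
    calc t.card = (t.image DyadicInterval.scale).card :=
          (Finset.card_image_of_injOn fun J hJ J' hJ' h =>
            DyadicInterval.eq_of_mem_of_scale_eq (hside J hJ) (hside J' hJ') h).symm
      _ ≤ (Finset.Ico I.scale (I.scale + A)).card := by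
          refine Finset.card_le_card fun z hz => ?_
          obtain ⟨J, hJ, rfl⟩ := Finset.mem_image.1 hz
          exact Finset.mem_Ico.2 ⟨hmin J hJ, hscale I hI J hJ⟩
      _ = A := by simp

/-- Sides are dilated one at a time: an interval fills the proportion 1/l of its l-dilate, and `hη`
says that 1 - 1/l < η. -/
lemma volume_iUnion_partialDilate_le (T : Set (DyadicRectangle n)) {l : ℚ} (hl : 1 ≤ l)
    {η C : ℝ≥0} (hC : (C + 2) * η ≤ C) (hη : (l : ℝ) < η * l + 1) (m : ℕ) (hm : m ≤ n) :
    volume (⋃ R ∈ T, partialDilate m l R) ≤ (1 + C) ^ m * volume (shadow T) := by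
  induction m with
  | zero => simp [partialDilate_zero, shadow]
  | succ m ih =>
    set W := ⋃ R ∈ T, partialDilate m l R with hW
    have hWm : MeasurableSet W :=
      MeasurableSet.biUnion (Set.to_countable _) fun R _ => measurableSet_partialDilate _ _ R
    have hl0 : (0 : ℝ) < l := by exact_mod_cast zero_lt_one.trans_le hl
    have hsub : (⋃ R ∈ T, partialDilate (m + 1) l R) ⊆ expandAlong ⟨m, hm⟩ η W := by
      refine Set.iUnion₂_subset fun R hR x hx => ?_
      set j : Fin n := ⟨m, hm⟩
      have hxj := hx j
      rw [partialFactor, if_pos (Nat.lt_succ_self m)] at hxj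
      refine mem_expandAlong (R j) l hxj ?_
      have hin : (R j).toSet ⊆ {t | update x j t ∈ W} := by
        intro t ht
        refine Set.mem_biUnion hR fun i => ?_
        rcases eq_or_ne i j with rfl | hij
        · have : ¬ ((j : Fin n) : ℕ) < m := lt_irrefl m
          rw [update_self, partialFactor, if_neg this, Rat.cast_one, DyadicInterval.dilate_one]
          exact ht
        · have e : update x j t i = x i := update_of_ne hij t x
          have hne : (i : ℕ) ≠ m := fun h => hij (Fin.ext h)
          have e' : (partialFactor m l i : ℚ) = partialFactor (m + 1) l i := by
            simp only [partialFactor]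
            congr 1
            exact propext ⟨fun h => by omega, fun h => by omega⟩
          rw [e, e']
          exact hx i
      have hlen := (R j).length_pos
      calc volume ((R j).dilate l \ {t | update x j t ∈ W})
          ≤ volume ((R j).dilate l \ (R j).dilate 1) := by
            rw [DyadicInterval.dilate_one]; gcongr
        _ = ENNReal.ofReal (l * (R j).length) - ENNReal.ofReal (1 * (R j).length) := by
            rw [measure_sdiff _ ((R j).measurableSet_dilate _).nullMeasurableSet
              (by simp [DyadicInterval.dilate]), DyadicInterval.volume_dilate,
              DyadicInterval.volume_dilate]
            rw [DyadicInterval.dilate_one]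
            exact (R j).toSet_subset_dilate (by exact_mod_cast hl)
        _ = ENNReal.ofReal (l * (R j).length - 1 * (R j).length) :=
            (ENNReal.ofReal_sub _ (by positivity)).symm
        _ < ENNReal.ofReal (η * (l * (R j).length)) := by
            rcases eq_or_ne η 0 with rfl | hη0
            · exact absurd hη (by simpa using (by exact_mod_cast hl : (1 : ℝ) ≤ l))
            have : (0 : ℝ) < η := by exact_mod_cast pos_iff_ne_zero.2 hη0
            rw [ENNReal.ofReal_lt_ofReal_iff (by positivity)]
            nlinarith
        _ = η * volume ((R j).dilate l) := by
            rw [ENNReal.ofReal_mul η.coe_nonneg, ENNReal.ofReal_coe_nnreal,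
              DyadicInterval.volume_dilate]
    calc volume (⋃ R ∈ T, partialDilate (m + 1) l R) ≤ volume (expandAlong ⟨m, hm⟩ η W) :=
          measure_mono hsub
      _ ≤ (1 + C) * volume W := volume_expandAlong_le _ η C hC hWm
      _ ≤ (1 + C) * ((1 + C) ^ m * volume (shadow T)) := by gcongr; exact ih (by omega)
      _ = (1 + C) ^ (m + 1) * volume (shadow T) := by ring

/-- The Carleson estimate for rectangles which expand inside `W` in the first `m` directions, but
not in the direction `m`. -/
lemma tsum_volume_le {η C₁ C₂ η₁ η₂ : ℝ≥0} {W : Set (Fin n → ℝ)} (hW : MeasurableSet W)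
    {T : Set (DyadicRectangle n)} {m : Fin n} {l : ℚ} (hl : 1 ≤ l) {A c : ℕ}
    (hA : l * 2 ^ c ≤ 2 ^ A) (hc : 2 ≤ η ^ n * 2 ^ c)
    (hC₁ : (C₁ + 2) * η₁ ≤ C₁) (hη₁ : 2 ^ c < 2 ^ c * η₁ ^ n + 1)
    (hC₂ : (C₂ + 2) * η₂ ≤ C₂) (hη₂ : (l : ℝ) < η₂ * l + 1)
    (h1 : ∀ R ∈ T, partialDilate m l R ⊆ W)
    (h2 : ∀ R ∈ T, ¬ partialDilate (m + 1) l R ⊆ expandList η W (List.finRange n)) :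
    ∑' I, volume (⋃ R ∈ {R ∈ T | R m = I}, R.toSet) ≤
      (1 + C₁) ^ n * (A * ((1 + C₂) ^ (m : ℕ) * volume (shadow T))) :=
  calc ∑' I, volume (⋃ R ∈ {R ∈ T | R m = I}, R.toSet)
      ≤ ∑' I, volume (sideUnion T m l I) := ENNReal.tsum_le_tsum fun I =>
        measure_mono (Set.iUnion₂_mono fun R _ => toSet_subset_partialDilate m hl R)
    _ ≤ ∑' I, (1 + C₁ : ℝ≥0∞) ^ n * volume (sideUnion T m l I \ longUnion T m l A I) :=
        ENNReal.tsum_le_tsum fun I => volume_sideUnion_le hl hC₁ hη₁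
          (fun R hR => volume_partialDilate_le hW hA hc h1 (h2 R hR)) I
    _ = (1 + C₁) ^ n * ∑' I, volume (sideUnion T m l I \ longUnion T m l A I) :=
        ENNReal.tsum_mul_left
    _ ≤ (1 + C₁) ^ n * (A * ((1 + C₂) ^ (m : ℕ) * volume (shadow T))) := by
        gcongr
        refine (tsum_volume_sideUnion_diff_le T m l A).trans ?_
        gcongr
        exact volume_iUnion_partialDilate_le T hl hC₂ hη₂ m m.2.le

/-! ### Choice of constants. -/

lemma add_two_mul_div (C : ℝ≥0) : (C + 2) * (C / (C + 2)) = C :=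
  mul_div_cancel₀ C (by positivity)

lemma exists_pos_pow_le (N : ℕ) {δ : ℝ} (hδ : 0 < δ) :
    ∃ C : ℝ≥0, 0 < C ∧ ((1 + C : ℝ≥0) : ℝ) ^ N ≤ 1 + δ := by
  have hcont : Continuous fun x : ℝ => (1 + x) ^ N := by fun_prop
  have hev : ∀ᶠ x in nhds (0 : ℝ), (1 + x) ^ N < 1 + δ :=
    hcont.continuousAt.eventually_lt continuousAt_const (by simpa using hδ)
  obtain ⟨x, hx, hx0⟩ := ((hev.filter_mono nhdsWithin_le_nhds).and
    (self_mem_nhdsWithin : ∀ᶠ x in nhdsWithin (0 : ℝ) (Set.Ioi 0), x ∈ Set.Ioi 0)).exists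
  exact ⟨⟨x, (Set.mem_Ioi.1 hx0).le⟩, Set.mem_Ioi.1 hx0, hx.le⟩

/-- With N = n 2^c and C = 2N the ratio is 1 - 1/(N+1), and Bernoulli bounds the loss by N/(N+1) <
1. -/
lemma exists_lt_mul_pow_add_one (n c : ℕ) :
    ∃ C : ℝ≥0, 2 ^ c < 2 ^ c * (C / (C + 2)) ^ n + 1 := by
  refine ⟨2 * (n * 2 ^ c), ?_⟩
  rw [← NNReal.coe_lt_coe]
  push_cast
  set N : ℝ := n * 2 ^ c with hN
  have hN0 : 0 ≤ N := by positivity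
  have hq : 2 * N / (2 * N + 2) = 1 + -(1 / (N + 1)) := by field_simp; ring
  have hle : 1 / (N + 1) ≤ 1 := by rw [div_le_one (by positivity)]; linarith
  have hb := one_add_mul_le_pow (a := -(1 / (N + 1))) (by linarith) n
  rw [hq]
  have h1 : N * (1 / (N + 1)) < 1 := by
    rw [mul_one_div, div_lt_one (by positivity)]; linarith
  have h2 : (2 : ℝ) ^ c * (1 + n * -(1 / (N + 1))) = 2 ^ c - N * (1 / (N + 1)) := by
    rw [hN]; ring
  have h3 := mul_le_mul_of_nonneg_left hb (by positivity : (0 : ℝ) ≤ 2 ^ c)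
  linarith

/-! ### Successive enlargements, the embedding factor and the stopping direction. -/

/-- The `m`-fold enlargement of `W`. -/
def expandIter (η : ℝ≥0) (W : Set (Fin n → ℝ)) : ℕ → Set (Fin n → ℝ)
  | 0 => W
  | m + 1 => expandList η (expandIter η W m) (List.finRange n)

lemma subset_expandIter (η : ℝ≥0) (W : Set (Fin n → ℝ)) (m : ℕ) : W ⊆ expandIter η W m := by
  induction m with
  | zero => exact subset_rfl
  | succ m ih => exact ih.trans (subset_expandList _ _ _)

lemma measurableSet_expandIter (η : ℝ≥0) {W : Set (Fin n → ℝ)} (hW : MeasurableSet W) (m : ℕ) :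
    MeasurableSet (expandIter η W m) := by
  induction m with
  | zero => exact hW
  | succ m ih => exact measurableSet_expandList _ ih _

lemma volume_expandIter_le (η C : ℝ≥0) (hC : (C + 2) * η ≤ C) {W : Set (Fin n → ℝ)}
    (hW : MeasurableSet W) (m : ℕ) :
    volume (expandIter η W m) ≤ (1 + C) ^ (n * m) * volume W := by
  induction m with
  | zero => simp [expandIter]
  | succ m ih =>
    have h := volume_expandList_le η C hC (measurableSet_expandIter η hW m) (List.finRange n)
    rw [List.length_finRange] at h
    calc volume (expandIter η W (m + 1)) ≤ (1 + C) ^ n * volume (expandIter η W m) := h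
      _ ≤ (1 + C) ^ n * ((1 + C) ^ (n * m) * volume W) := by gcongr
      _ = (1 + C) ^ (n * (m + 1)) * volume W := by ring

lemma measurableSet_shadow (U : Set (DyadicRectangle n)) : MeasurableSet (shadow U) := by
  have h : shadow U = ⋃ R ∈ U, partialDilate 0 1 R := by simp [shadow, partialDilate_zero]
  rw [h]
  exact MeasurableSet.biUnion (Set.to_countable _) fun R _ => measurableSet_partialDilate _ _ R

/-- In a set of finite measure there is a last dilate of `R` by a power of `2`. -/
lemma exists_last_dilate (hn : 1 ≤ n) {V : Set (Fin n → ℝ)} (hV : volume V < ∞)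
    {R : DyadicRectangle n} (hR : R.toSet ⊆ V) :
    ∃ k : ℕ, R.dilate ((2 : ℝ) ^ k) ⊆ V ∧ ¬ R.dilate ((2 : ℝ) ^ (k + 1)) ⊆ V := by
  by_contra! h
  have hall : ∀ k : ℕ, R.dilate ((2 : ℝ) ^ k) ⊆ V := by
    intro k
    induction k with
    | zero =>
      have h1 : R.dilate 1 = R.toSet := by
        simp [DyadicRectangle.dilate, DyadicRectangle.toSet, DyadicInterval.dilate_one]
      rwa [pow_zero, h1]
    | succ k ih => exact h k ih
  -- The dilates exhaust the space, which has infinite measure because n ≥ 1.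
  have huniv : V = Set.univ := by
    refine Set.eq_univ_of_forall fun x => ?_
    have hev : ∀ᶠ k : ℕ in Filter.atTop, ∀ i, x i ∈ (R i).dilate ((2 : ℝ) ^ k) := by
      refine Filter.eventually_all.2 fun i => ?_
      have hl := (R i).length_pos
      filter_upwards [(tendsto_pow_atTop_atTop_of_one_lt (one_lt_two : (1 : ℝ) < 2)).eventually_gt_atTop
        (2 * |x i - (R i).center| / (R i).length)] with k hk
      rw [div_lt_iff₀ hl] at hk
      have h1 := abs_le.1 (le_refl |x i - (R i).center|)
      exact ⟨by linarith [h1.1], by linarith [h1.2]⟩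
    obtain ⟨k, hk⟩ := hev.exists
    exact hall k hk
  rw [huniv, volume_pi, Measure.pi_univ] at hV
  simp only [Real.volume_univ, Finset.prod_const, Finset.card_univ, Fintype.card_fin] at hV
  rw [ENNReal.top_pow (by omega)] at hV
  exact lt_irrefl _ hV

/-- The first direction in which a rectangle stops expanding inside the successive enlargements. -/
lemma exists_stopping_direction {η : ℝ≥0} {W : Set (Fin n → ℝ)} {l : ℚ} {R : DyadicRectangle n}
    (hR : R.toSet ⊆ W) (h : ¬ R.dilate l ⊆ expandIter η W n) :
    ∃ m : Fin n, partialDilate m l R ⊆ expandIter η W m ∧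
      ¬ partialDilate (m + 1) l R ⊆ expandIter η W (m + 1) := by
  by_contra! hcon
  have hall : ∀ m ≤ n, partialDilate m l R ⊆ expandIter η W m := by
    intro m
    induction m with
    | zero => intro _; rw [partialDilate_zero]; exact hR
    | succ m ih => intro hm; exact hcon ⟨m, hm⟩ (ih (by omega))
  exact h (partialDilate_self l R ▸ hall n le_rfl)

/-- The terms of the final geometric series. -/
lemma summable_level_bound (c : ℕ) {ε : ℝ} (hε : 0 < ε) (B : ℝ) :
    Summable fun k : ℕ => B * (((k + 1 + c : ℕ) : ℝ) * ((2 : ℝ) ^ (-ε)) ^ k) := by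
  have hr0 : (0 : ℝ) < 2 ^ (-ε) := by positivity
  have hr1 : (2 : ℝ) ^ (-ε) < 1 := Real.rpow_lt_one_of_one_lt_of_neg one_lt_two (by linarith)
  have hn : ‖(2 : ℝ) ^ (-ε)‖ < 1 := by rwa [Real.norm_of_nonneg hr0.le]
  have h1 := summable_pow_mul_geometric_of_norm_lt_one 1 hn
  have h0 := (summable_geometric_of_norm_lt_one hn).mul_left (1 + c : ℝ)
  refine ((h1.add h0).congr fun k => ?_).mul_left B
  push_cast
  ring

end Journe

/-! ### Assembly of the estimate. -/

open Journe in
theorem lemmal (n : ℕ) (hn : 1 ≤ n) (δ ε : ℝ) (hδ : 0 < δ) (hε : 0 < ε) :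
    ∃ K : ℝ≥0, ∀ U : Set (Journe.DyadicRectangle n), volume (Journe.shadow U) < ∞ →
      ∃ (V : Set (Fin n → ℝ)) (emb : Journe.DyadicRectangle n → ℝ)
        (coord : Journe.DyadicRectangle n → Fin n),
        MeasurableSet V ∧
        Journe.shadow U ⊆ V ∧
        volume V ≤ ENNReal.ofReal (1 + δ) * volume (Journe.shadow U) ∧
        (∀ R ∈ U, 1 ≤ emb R) ∧
        (∀ R ∈ U, R.dilate (emb R) ⊆ V) ∧
        ∀ U' ⊆ U,
          ∑' k : ℕ, ∑ m : Fin n, ∑' I : Journe.DyadicInterval,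
              ENNReal.ofReal ((2 : ℝ) ^ (-((n : ℝ) + ε) * (k : ℝ))) *
                volume (Journe.levelUnion emb coord I k m U') ≤
            (K : ℝ≥0∞) * volume (Journe.shadow U') := by
  -- There are n rounds of enlargement in n directions each.
  obtain ⟨C, hC0, hCδ⟩ := exists_pos_pow_le (n * n) hδ
  set η : ℝ≥0 := C / (C + 2) with hη
  have hη0 : 0 < η := by positivity
  obtain ⟨c, hc⟩ := pow_unbounded_of_one_lt (2 / η ^ n) (one_lt_two : (1 : ℝ≥0) < 2)
  rw [div_lt_iff₀' (by positivity)] at hc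
  obtain ⟨C₁, hη₁⟩ := exists_lt_mul_pow_add_one n c
  -- The factor n counts the directions, (1 + C₁)^n is the cost of recovering the side unions, and
  -- 16^n comes from (2^(k+4))^n.
  set B : ℝ := n * ((1 + C₁) ^ n * 16 ^ n) with hB
  have hsum := summable_level_bound c hε B
  have hterm : ∀ k : ℕ, 0 ≤ B * (((k + 1 + c : ℕ) : ℝ) * ((2 : ℝ) ^ (-ε)) ^ k) :=
    fun k => by positivity
  refine ⟨(∑' k : ℕ, B * (((k + 1 + c : ℕ) : ℝ) * ((2 : ℝ) ^ (-ε)) ^ k)).toNNReal,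
    fun U hU => ?_⟩
  have : Nonempty (Fin n) := ⟨⟨0, hn⟩⟩
  set V := expandIter η (shadow U) n with hVdef
  have hUm := measurableSet_shadow U
  have hVvol : volume V ≤ ENNReal.ofReal (1 + δ) * volume (shadow U) := by
    refine (volume_expandIter_le η C (add_two_mul_div C).le hUm n).trans ?_
    gcongr
    rw [show (1 + C : ℝ≥0∞) = ((1 + C : ℝ≥0) : ℝ≥0∞) by push_cast; rfl, ← ENNReal.coe_pow,
      ← ENNReal.ofReal_coe_nnreal]
    exact ENNReal.ofReal_le_ofReal (by exact_mod_cast hCδ)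
  have hVfin : volume V < ∞ := hVvol.trans_lt (ENNReal.mul_lt_top ENNReal.ofReal_lt_top hU)
  have hex : ∀ R ∈ U, ∃ (k : ℕ) (m : Fin n), R.dilate ((2 : ℝ) ^ k) ⊆ V ∧
      partialDilate m (2 ^ (k + 1)) R ⊆ expandIter η (shadow U) m ∧
      ¬ partialDilate (m + 1) (2 ^ (k + 1)) R ⊆ expandIter η (shadow U) (m + 1) := by
    intro R hR
    have hRU : R.toSet ⊆ shadow U := Set.subset_biUnion_of_mem hR
    obtain ⟨k, hk, hk'⟩ := exists_last_dilate hn hVfin (hRU.trans (subset_expandIter η _ n))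
    obtain ⟨m, hm⟩ := exists_stopping_direction (η := η) (l := 2 ^ (k + 1)) hRU
      (by push_cast; exact hk')
    exact ⟨k, m, hk, hm⟩
  choose! κ coord hκ using hex
  refine ⟨V, fun R => 2 ^ κ R, coord, measurableSet_expandIter η hUm n, subset_expandIter η _ n,
    hVvol, fun R _ => one_le_pow₀ one_le_two, fun R hR => (hκ R hR).1, fun U' hU' => ?_⟩
  have hlevel : ∀ (k : ℕ) (m : Fin n),
      ∑' I, volume (levelUnion (fun R => 2 ^ κ R) coord I k m U') ≤
        (1 + C₁) ^ n * ((k + 1 + c : ℕ) * ((2 ^ (k + 4)) ^ n * volume (shadow U'))) := by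
    intro k m
    set T := {R ∈ U' | κ R = k ∧ coord R = m} with hT
    have hl : (1 : ℚ) ≤ 2 ^ (k + 1) := one_le_pow₀ one_le_two
    -- Here 1 - η₂ = 2/(C₂ + 2) must be less than 1/l; C₂ = 4l suffices.
    have hC₂ := add_two_mul_div (2 ^ (k + 3))
    have hη₂ : (((2 ^ (k + 1) : ℚ)) : ℝ) <
        ((2 ^ (k + 3) / (2 ^ (k + 3) + 2) : ℝ≥0) : ℝ) * ((2 ^ (k + 1) : ℚ) : ℝ) + 1 := by
      push_cast
      have hx : (1 : ℝ) ≤ 2 ^ k := one_le_pow₀ one_le_two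
      rw [pow_add, pow_add, div_mul_eq_mul_div, ← sub_lt_iff_lt_add, lt_div_iff₀ (by positivity)]
      nlinarith
    -- This `A` gives l 2^c = 2^A exactly; its linear growth in k is absorbed by ε.
    have hmain := tsum_volume_le (A := k + 1 + c) (measurableSet_expandIter η hUm m) (T := T)
      (m := m) hl (by rw [← pow_add]) hc.le (add_two_mul_div C₁).le hη₁ hC₂.le hη₂
      (fun R hR => by have := (hκ R (hU' hR.1)).2.1; rwa [hR.2.1, hR.2.2] at this)
      (fun R hR => by have := (hκ R (hU' hR.1)).2.2; rwa [hR.2.1, hR.2.2] at this)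
    have hpow : (1 + ((2 ^ (k + 3) : ℝ≥0) : ℝ≥0∞)) ^ (m : ℕ) ≤ (2 ^ (k + 4)) ^ n := by
      have h1 : (1 : ℝ≥0) + 2 ^ (k + 3) ≤ 2 ^ (k + 4) := by
        have : (1 : ℝ≥0) ≤ 2 ^ (k + 3) := one_le_pow₀ one_le_two
        rw [pow_succ _ (k + 3), mul_two]
        gcongr
      have h2 : ((1 : ℝ≥0) + 2 ^ (k + 3)) ^ (m : ℕ) ≤ (2 ^ (k + 4)) ^ n :=
        (pow_le_pow_right₀ le_self_add m.2.le).trans (pow_le_pow_left' h1 n)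
      exact_mod_cast h2
    calc ∑' I, volume (levelUnion (fun R => 2 ^ κ R) coord I k m U')
        ≤ ∑' I, volume (⋃ R ∈ {R ∈ T | R m = I}, R.toSet) := by
          refine ENNReal.tsum_le_tsum fun I => measure_mono (Set.biUnion_subset_biUnion_left ?_)
          rintro R ⟨hR, h1, h2, h3, h4⟩
          -- The embedding factor is an exact power of 2, so the level determines its exponent.
          have h1' := (pow_le_pow_iff_right₀ (one_lt_two : (1 : ℝ) < 2)).1 h1
          have h2' := (pow_lt_pow_iff_right₀ (one_lt_two : (1 : ℝ) < 2)).1 h2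
          exact ⟨⟨hR, by omega, h3⟩, h4⟩
      _ ≤ _ := hmain
      _ ≤ (1 + C₁) ^ n * ((k + 1 + c : ℕ) * ((2 ^ (k + 4)) ^ n * volume (shadow U'))) := by
          gcongr
          exact Set.biUnion_subset_biUnion_left fun R hR => hR.1
  have hweight : ∀ k : ℕ, (n : ℝ≥0∞) * (ENNReal.ofReal ((2 : ℝ) ^ (-((n : ℝ) + ε) * (k : ℝ))) *
      ((1 + C₁) ^ n * ((k + 1 + c : ℕ) * (2 ^ (k + 4)) ^ n))) =
      ENNReal.ofReal (B * (((k + 1 + c : ℕ) : ℝ) * ((2 : ℝ) ^ (-ε)) ^ k)) := by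
    intro k
    have e : ((n : ℝ≥0∞) * (ENNReal.ofReal ((2 : ℝ) ^ (-((n : ℝ) + ε) * (k : ℝ))) *
        ((1 + C₁) ^ n * ((k + 1 + c : ℕ) * (2 ^ (k + 4)) ^ n)))) =
        ENNReal.ofReal (n * ((2 : ℝ) ^ (-((n : ℝ) + ε) * (k : ℝ)) *
          ((1 + C₁) ^ n * ((k + 1 + c : ℕ) * (2 ^ (k + 4)) ^ n)))) := by
      rw [ENNReal.ofReal_mul (by positivity), ENNReal.ofReal_mul (by positivity),
        ENNReal.ofReal_mul (by positivity), ENNReal.ofReal_mul (by positivity),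
        ENNReal.ofReal_pow (by positivity), ENNReal.ofReal_pow (by positivity),
        ENNReal.ofReal_pow (by positivity), ENNReal.ofReal_add (by positivity) (by positivity)]
      simp only [ENNReal.ofReal_natCast, ENNReal.ofReal_one, ENNReal.ofReal_coe_nnreal,
        ENNReal.ofReal_ofNat]
    rw [e]
    congr 1
    -- The n in the weight cancels the growth 2^(nk), leaving a geometric factor from ε.
    have e2 : (2 : ℝ) ^ (-((n : ℝ) + ε) * (k : ℝ)) * (2 ^ k) ^ n = ((2 : ℝ) ^ (-ε)) ^ k := by
      rw [← pow_mul, ← Real.rpow_natCast, ← Real.rpow_natCast, ← Real.rpow_mul (by norm_num),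
        ← Real.rpow_add (by norm_num)]
      congr 1
      push_cast
      ring
    rw [← e2, hB, pow_add, mul_pow]
    norm_num
    ring
  calc ∑' k : ℕ, ∑ m : Fin n, ∑' I : DyadicInterval,
        ENNReal.ofReal ((2 : ℝ) ^ (-((n : ℝ) + ε) * (k : ℝ))) *
          volume (levelUnion (fun R => 2 ^ κ R) coord I k m U')
      ≤ ∑' k : ℕ, ∑ _m : Fin n, ENNReal.ofReal ((2 : ℝ) ^ (-((n : ℝ) + ε) * (k : ℝ))) *
          ((1 + C₁) ^ n * ((k + 1 + c : ℕ) * ((2 ^ (k + 4)) ^ n * volume (shadow U')))) := by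
        refine ENNReal.tsum_le_tsum fun k => Finset.sum_le_sum fun m _ => ?_
        rw [ENNReal.tsum_mul_left]
        gcongr
        exact hlevel k m
    _ = ∑' k : ℕ, ENNReal.ofReal (B * (((k + 1 + c : ℕ) : ℝ) * ((2 : ℝ) ^ (-ε)) ^ k)) *
          volume (shadow U') := by
        refine tsum_congr fun k => ?_
        rw [Finset.sum_const, Finset.card_univ, Fintype.card_fin, nsmul_eq_mul, ← hweight k]
        ring
    _ = _ := by
        rw [ENNReal.tsum_mul_right, ← ENNReal.ofReal_tsum_of_nonneg hterm hsum]
        rfl
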